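/- Let $n \geq 3$ and let $F_n$ be the free group on $x_1, \dots, x_n$. For a group $G$ let $R(G) = \mathrm{Hom}(G, \mathrm{SL}(2,\mathbb{C}))$, and for $x \in G$ let $\mathrm{tr}\,x : R(G) \to \mathbb{C}$ be the function $\rho \mapsto \mathrm{tr}\,\rho(x)$. The $\mathbb{Q}$-linear span $\mathfrak{X}_{\mathbb{Q}}(G)$ of all $\mathrm{tr}\,x$ ($x \in G$) is a subring of the ring of functions $R(G) \to \mathbb{C}$ (the ring of Fricke characters of $G$ over $\mathbb{Q}$), and $\mathrm{Aut}\,G$ acts on it by ring automorphisms with $\sigma \cdot \mathrm{tr}\,x = \mathrm{tr}\,\sigma(x)$. Let $J \subset \mathfrak{X}_{\mathbb{Q}}(F_n)$ be the ideal generated by the elements $\mathrm{tr}(x_{i_1} \cdots x_{i_l}) - 2$ with $1 \leq l \leq 3$ and $1 \leq i_1 < \cdots < i_l \leq n$; it is stable under $\mathrm{Aut}\,F_n$. For $k \geq 1$ let \[ \mathcal{E}_{F_n}(k) = \mathrm{Ker}\bigl(\mathrm{Aut}\,F_n \to \mathrm{Aut}(J/J^{k+1})\bigr), \qquad \mathcal{A}_{F_n}(k)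 = \mathrm{Ker}\bigl(\mathrm{Aut}\,F_n \to \mathrm{Aut}(F_n/\Gamma(k+1))\bigr), \] where $\Gamma(1) = F_n$ and $\Gamma(k+1) = [\Gamma(k), F_n]$, and let $\mathrm{Inn}\,F_n$ be the group of inner automorphisms. Then \[ \mathcal{E}_{F_n}(1) = \mathrm{Inn}\,F_n \cdot \mathcal{A}_{F_n}(2). \] -/

import Mathlib

noncomputable section

namespace Fricke

open Matrix

section General

variable (G : Type*) [Group G]

/-- `R(G) = Hom(G, SL(2, ℂ))`. -/
abbrev Reps : Type _ := G →* SpecialLinearGroup (Fin 2) ℂ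

variable {G}

/-- The function `tr x : R(G) → ℂ`, `ρ ↦ tr ρ(x)`. -/
def trFun (x : G) : Reps G → ℂ := fun ρ => Matrix.trace (ρ x : Matrix (Fin 2) (Fin 2) ℂ)

theorem sl2_trace_mul (A B : SpecialLinearGroup (Fin 2) ℂ) :
    Matrix.trace A.1 * Matrix.trace B.1 = Matrix.trace (A * B).1 + Matrix.trace (A * B⁻¹).1 := by
  have h1 : (A * B).1 = A.1 * B.1 := rfl
  have h2 : (A * B⁻¹).1 = A.1 * adjugate B.1 := rfl
  rw [h1, h2, adjugate_fin_two]
  simp only [Matrix.trace_fin_two, Matrix.mul_apply, Fin.sum_univ_two, Matrix.of_apply,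
    Matrix.cons_val_zero, Matrix.cons_val_one, Matrix.cons_val']
  ring

theorem trFun_mul (x y : G) : trFun x * trFun y = trFun (x * y) + trFun (x * y⁻¹) := by
  funext ρ
  simpa [trFun] using sl2_trace_mul (ρ x) (ρ y)

theorem trFun_one : trFun (1 : G) = 2 := by
  funext ρ
  simp [trFun]

variable (G) in
/-- The ring of Fricke characters of `G` over `ℚ`: the `ℚ`-linear span of the functions `tr x`,
`x ∈ G`, inside the algebra of all functions `R(G) → ℂ`; it is closed under multiplication. -/
def frickeSubalgebra : Subalgebra ℚ (Reps G → ℂ) :=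
  (Submodule.span ℚ (Set.range (trFun (G := G)))).toSubalgebra
    (by
      have h : (1 : Reps G → ℂ) = (2⁻¹ : ℚ) • trFun (1 : G) := by
        rw [trFun_one]
        funext ρ
        simp [Rat.smul_def]
      rw [h]
      exact Submodule.smul_mem _ _ (Submodule.subset_span ⟨1, rfl⟩))
    (by
      intro a b ha hb
      have hab := Submodule.mul_mem_mul ha hb
      rw [Submodule.span_mul_span] at hab
      refine Submodule.span_le.2 ?_ hab
      rintro _ ⟨_, ⟨x, rfl⟩, _, ⟨y, rfl⟩, rfl⟩
      change trFun x * trFun y ∈ _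
      rw [trFun_mul]
      exact Submodule.add_mem _ (Submodule.subset_span ⟨_, rfl⟩)
        (Submodule.subset_span ⟨_, rfl⟩))

theorem mem_frickeSubalgebra {f : Reps G → ℂ} :
    f ∈ frickeSubalgebra G ↔ f ∈ Submodule.span ℚ (Set.range (trFun (G := G))) := Iff.rfl

variable (G) in
/-- The subalgebra `frickeSubalgebra G` as a commutative ring. -/
def FrickeRing : Type _ := frickeSubalgebra G

instance : CommRing (FrickeRing G) := inferInstanceAs (CommRing (frickeSubalgebra G))

instance : Algebra ℚ (FrickeRing G) := inferInstanceAs (Algebra ℚ (frickeSubalgebra G))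

/-- The Fricke character `tr x` as an element of the ring of Fricke characters. -/
def tr (x : G) : FrickeRing G := ⟨trFun x, Submodule.subset_span ⟨x, rfl⟩⟩

/-- The action of `σ ∈ Aut G` on functions on `R(G)`: `(σ χ)(ρ) = χ(ρ ∘ σ)`. -/
def funAct (σ : MulAut G) : (Reps G → ℂ) →ₐ[ℚ] (Reps G → ℂ) where
  toFun χ ρ := χ (ρ.comp σ.toMonoidHom)
  map_one' := rfl
  map_mul' _ _ := rfl
  map_zero' := rfl
  map_add' _ _ := rfl
  commutes' _ := rfl

theorem funAct_trFun (σ : MulAut G) (x : G) : funAct σ (trFun x) = trFun (σ x) := rfl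

theorem funAct_mem (σ : MulAut G) {f : Reps G → ℂ} (hf : f ∈ frickeSubalgebra G) :
    funAct σ f ∈ frickeSubalgebra G := by
  rw [mem_frickeSubalgebra] at hf ⊢
  induction hf using Submodule.span_induction with
  | mem f hf =>
    obtain ⟨x, rfl⟩ := hf
    exact Submodule.subset_span ⟨σ x, rfl⟩
  | zero => rw [map_zero]; exact Submodule.zero_mem _
  | add f g _ _ hf hg => rw [map_add]; exact Submodule.add_mem _ hf hg
  | smul c f _ hf => rw [map_smul]; exact Submodule.smul_mem _ _ hf

/-- The action of `σ ∈ Aut G` on the ring of Fricke characters; it sends `tr x` to `tr (σ x)`. -/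
def frickeAct (σ : MulAut G) : FrickeRing G →ₐ[ℚ] FrickeRing G :=
  ((funAct σ).comp (frickeSubalgebra G).val).codRestrict (frickeSubalgebra G)
    fun f => funAct_mem σ f.2

theorem frickeAct_tr (σ : MulAut G) (x : G) : frickeAct σ (tr x) = tr (σ x) := rfl

variable (G) in
/-- The ring of Fricke characters as a representation of `Aut G` over `ℚ`. -/
def frickeRep : Representation ℚ (MulAut G) (FrickeRing G) where
  toFun σ := (frickeAct σ).toLinearMap
  map_one' := rfl
  map_mul' _ _ := rfl

/-! Trace identities. -/

theorem tr_one : tr (1 : G) = 2 := Subtype.ext trFun_one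

theorem tr_mul (x y : G) : tr x * tr y = tr (x * y) + tr (x * y⁻¹) :=
  Subtype.ext (trFun_mul x y)

theorem tr_comm (x y : G) : tr (x * y) = tr (y * x) := by
  apply Subtype.ext
  funext ρ
  change Matrix.trace (ρ (x * y)).1 = Matrix.trace (ρ (y * x)).1
  rw [map_mul, map_mul]
  exact Matrix.trace_mul_comm (ρ x).1 (ρ y).1

theorem coe_rep_mul (ρ : Reps G) (x y : G) : (ρ (x * y)).1 = (ρ x).1 * (ρ y).1 := by
  rw [map_mul]
  rfl

theorem trFun_swap (x y z : G) : trFun (x * y * z) + trFun (y * x * z) =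
    trFun x * trFun (y * z) + trFun y * trFun (x * z) + trFun z * trFun (x * y)
      - trFun x * trFun y * trFun z := by
  funext ρ
  simp only [trFun, Pi.add_apply, Pi.sub_apply, Pi.mul_apply, coe_rep_mul,
    Matrix.trace_fin_two, Matrix.mul_apply, Fin.sum_univ_two]
  ring

theorem tr_swap (x y z : G) : tr (x * y * z) + tr (y * x * z) =
    tr x * tr (y * z) + tr y * tr (x * z) + tr z * tr (x * y) - tr x * tr y * tr z :=
  Subtype.ext (trFun_swap x y z)

theorem trFun_four (x y z w : G) : trFun (x * y * z * w) + trFun (x * y * z * w) =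
    trFun x * trFun (y * z * w) + trFun y * trFun (z * w * x) + trFun z * trFun (w * x * y)
      + trFun w * trFun (x * y * z) + trFun (x * y) * trFun (z * w)
      - trFun (x * z) * trFun (y * w) + trFun (x * w) * trFun (y * z)
      - trFun x * trFun y * trFun (z * w) - trFun y * trFun z * trFun (x * w)
      - trFun x * trFun w * trFun (y * z) - trFun z * trFun w * trFun (x * y)
      + trFun x * trFun y * trFun z * trFun w := by
  funext ρ
  simp only [trFun, Pi.add_apply, Pi.sub_apply, Pi.mul_apply, coe_rep_mul,
    Matrix.trace_fin_two, Matrix.mul_apply, Fin.sum_univ_two]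
  ring

theorem tr_four (x y z w : G) : tr (x * y * z * w) + tr (x * y * z * w) =
    tr x * tr (y * z * w) + tr y * tr (z * w * x) + tr z * tr (w * x * y) + tr w * tr (x * y * z)
      + tr (x * y) * tr (z * w) - tr (x * z) * tr (y * w) + tr (x * w) * tr (y * z)
      - tr x * tr y * tr (z * w) - tr y * tr z * tr (x * w) - tr x * tr w * tr (y * z)
      - tr z * tr w * tr (x * y) + tr x * tr y * tr z * tr w :=
  Subtype.ext (trFun_four x y z w)

/-- The action of `Aut G` on the quotient of `G` by a characteristic subgroup. -/
def autQuotient (N : Subgroup G) [N.Characteristic] : MulAut G →* MulAut (G ⧸ N) where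
  toFun σ := QuotientGroup.congr N N σ (Subgroup.characteristic_iff_map_eq.1 inferInstance σ)
  map_one' := by
    ext x
    induction x using QuotientGroup.induction_on
    rfl
  map_mul' σ τ := by
    ext x
    induction x using QuotientGroup.induction_on
    rfl

variable (G) in
/-- The `k`-th term `A_G(k)` of the Andreadakis–Johnson filtration: the kernel of
`Aut G → Aut (G / Γ_G(k + 1))`. With `Γ_G(1) = G`, the subgroup `Γ_G(k + 1)` is
`(⊤ : Subgroup G).lowerCentralSeries k`. -/
def andreadakisJohnson (k : ℕ) : Subgroup (MulAut G) :=
  (autQuotient ((⊤ : Subgroup G).lowerCentralSeries k)).ker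

end General

section Free

variable (n : ℕ)

/-- The elements `tr (x_{i₁} ⋯ x_{i_l}) - 2` with `1 ≤ l ≤ 3` and `i₁ < ⋯ < i_l`. -/
def genSet : Set (FrickeRing (FreeGroup (Fin n))) :=
  {f | ∃ w : List (Fin n), 1 ≤ w.length ∧ w.length ≤ 3 ∧ w.Pairwise (· < ·) ∧
    f = tr (w.map FreeGroup.of).prod - 2}

/-- The ideal `J` of the ring of Fricke characters of `F_n`. -/
def J : Ideal (FrickeRing (FreeGroup (Fin n))) := Ideal.span (genSet n)

variable {n}

/-- `tr x ≡ 2` modulo `J`. -/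
def IsTwo (x : FreeGroup (Fin n)) : Prop := Ideal.Quotient.mk (J n) (tr x) = 2

theorem IsTwo.comm {x y : FreeGroup (Fin n)} (h : IsTwo (x * y)) : IsTwo (y * x) := by
  unfold IsTwo
  rw [tr_comm]
  exact h

theorem isTwo_one : IsTwo (1 : FreeGroup (Fin n)) := by
  unfold IsTwo
  rw [tr_one, map_ofNat]

theorem IsTwo.mul_iff {x y : FreeGroup (Fin n)} (hx : IsTwo x) (hy : IsTwo y) :
    IsTwo (x * y) ↔ IsTwo (x * y⁻¹) := by
  have h := congrArg (Ideal.Quotient.mk (J n)) (tr_mul x y)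
  unfold IsTwo at *
  rw [map_mul, map_add, hx, hy] at h
  constructor <;> intro h'
  · rw [h'] at h; linear_combination -h
  · rw [h'] at h; linear_combination -h

theorem IsTwo.swap {x y z : FreeGroup (Fin n)} (hx : IsTwo x) (hy : IsTwo y) (hz : IsTwo z)
    (hxy : IsTwo (x * y)) (hxz : IsTwo (x * z)) (hyz : IsTwo (y * z))
    (h : IsTwo (x * y * z)) : IsTwo (y * x * z) := by
  have e := congrArg (Ideal.Quotient.mk (J n)) (tr_swap x y z)
  unfold IsTwo at *
  repeat rw [RingHom.map_add] at e
  repeat rw [RingHom.map_sub] at e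
  repeat rw [RingHom.map_add] at e
  repeat rw [RingHom.map_mul] at e
  rw [hx, hy, hz, hxy, hxz, hyz, h] at e
  linear_combination e

theorem IsTwo.four {x y z w : FreeGroup (Fin n)} (hx : IsTwo x) (hy : IsTwo y) (hz : IsTwo z)
    (hw : IsTwo w) (hxy : IsTwo (x * y)) (hxz : IsTwo (x * z)) (hxw : IsTwo (x * w))
    (hyz : IsTwo (y * z)) (hyw : IsTwo (y * w)) (hzw : IsTwo (z * w)) (h1 : IsTwo (y * z * w))
    (h2 : IsTwo (z * w * x)) (h3 : IsTwo (w * x * y)) (h4 : IsTwo (x * y * z)) :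
    IsTwo (x * y * z * w) := by
  have e := congrArg (Ideal.Quotient.mk (J n)) (tr_four x y z w)
  unfold IsTwo at *
  simp only [RingHom.map_mul, RingHom.map_add, RingHom.map_sub,
    hx, hy, hz, hw, hxy, hxz, hxw, hyz, hyw, hzw, h1, h2, h3, h4] at e
  have h2 : (algebraMap ℚ (FrickeRing (FreeGroup (Fin n)) ⧸ J n) 2⁻¹) * 2 = 1 := by
    rw [← map_ofNat (algebraMap ℚ (FrickeRing (FreeGroup (Fin n)) ⧸ J n)) 2, ← map_mul]
    norm_num
  linear_combination (algebraMap ℚ (FrickeRing (FreeGroup (Fin n)) ⧸ J n) 2⁻¹) * e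
    - (Ideal.Quotient.mk (J n) (tr (x * y * z * w)) - 2) * h2

theorem isTwo_gen (w : List (Fin n)) (h1 : 1 ≤ w.length) (h3 : w.length ≤ 3)
    (hw : w.Pairwise (· < ·)) : IsTwo (w.map FreeGroup.of).prod := by
  have h : tr (w.map FreeGroup.of).prod - 2 ∈ J n := Ideal.subset_span ⟨w, h1, h3, hw, rfl⟩
  have := Ideal.Quotient.eq.2 h
  rwa [map_ofNat] at this

theorem isTwo_length_one (a : Fin n) : IsTwo (FreeGroup.of a) := by
  simpa using isTwo_gen [a] (by simp) (by simp) (by simp)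

theorem isTwo_length_two (a b : Fin n) : IsTwo (FreeGroup.of a * FreeGroup.of b) := by
  rcases lt_trichotomy a b with h | h | h
  · simpa using isTwo_gen [a, b] (by simp) (by simp) (by simp [h])
  · subst h
    rw [IsTwo.mul_iff (isTwo_length_one a) (isTwo_length_one a), mul_inv_cancel]
    exact isTwo_one
  · exact IsTwo.comm (by simpa using isTwo_gen [b, a] (by simp) (by simp) (by simp [h]))

theorem isTwo_rotate {x y z : FreeGroup (Fin n)} (h : IsTwo (x * y * z)) : IsTwo (y * z * x) := by
  rw [mul_assoc] at h
  exact h.comm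

theorem isTwo_transpose {a b c : Fin n}
    (h : IsTwo (FreeGroup.of a * FreeGroup.of b * FreeGroup.of c)) :
    IsTwo (FreeGroup.of b * FreeGroup.of a * FreeGroup.of c) :=
  IsTwo.swap (isTwo_length_one a) (isTwo_length_one b) (isTwo_length_one c)
    (isTwo_length_two a b) (isTwo_length_two a c) (isTwo_length_two b c) h

theorem isTwo_repeat (a c : Fin n) :
    IsTwo (FreeGroup.of a * FreeGroup.of c * FreeGroup.of a) := by
  rw [IsTwo.mul_iff (isTwo_length_two a c) (isTwo_length_one a)]
  apply IsTwo.comm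
  rw [← mul_assoc, inv_mul_cancel, one_mul]
  exact isTwo_length_one c

theorem isTwo_length_three (a b c : Fin n) :
    IsTwo (FreeGroup.of a * FreeGroup.of b * FreeGroup.of c) := by
  have key : ∀ {a b c : Fin n}, a < b → b < c →
      IsTwo (FreeGroup.of a * FreeGroup.of b * FreeGroup.of c) := by
    intro a b c hab hbc
    simpa [mul_assoc] using
      isTwo_gen [a, b, c] (by simp) (by simp) (by simp [hab, hbc, hab.trans hbc])
  rcases lt_trichotomy a b with hab | rfl | hab
  · rcases lt_trichotomy b c with hbc | rfl | hbc
    · exact key hab hbc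
    · exact isTwo_rotate (isTwo_repeat b a)
    · rcases lt_trichotomy a c with hac | rfl | hac
      · exact isTwo_rotate (isTwo_transpose (key hac hbc))
      · exact isTwo_repeat a b
      · exact isTwo_rotate (key hac hab)
  · exact isTwo_rotate (isTwo_rotate (isTwo_repeat a c))
  · rcases lt_trichotomy b c with hbc | rfl | hbc
    · rcases lt_trichotomy a c with hac | rfl | hac
      · exact isTwo_transpose (key hab hac)
      · exact isTwo_repeat a b
      · exact isTwo_rotate (isTwo_rotate (key hbc hac))
    · exact isTwo_rotate (isTwo_repeat b a)
    · exact isTwo_transpose (isTwo_rotate (key hbc hab))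

theorem isTwo_word (w : List (Fin n)) : IsTwo (w.map FreeGroup.of).prod := by
  induction hl : w.length using Nat.strong_induction_on generalizing w with
  | _ m ih =>
    have ih' : ∀ u : List (Fin n), u.length < w.length → IsTwo (u.map FreeGroup.of).prod :=
      fun u hu => ih _ (hl ▸ hu) u rfl
    match w, ih' with
    | [], _ => simpa using isTwo_one
    | [a], _ => simpa using isTwo_length_one a
    | [a, b], _ => simpa using isTwo_length_two a b
    | [a, b, c], _ => simpa [mul_assoc] using isTwo_length_three a b c
    | a :: b :: c :: d :: v, ih' =>
      have hv := ih' (d :: v) (by simp)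
      have h1 := ih' (b :: c :: d :: v) (by simp)
      have h2 := ih' (c :: (d :: v) ++ [a]) (by simp)
      have h3 := ih' ((d :: v) ++ [a, b]) (by simp)
      have h4 := ih' (a :: d :: v) (by simp)
      have h5 := ih' (b :: d :: v) (by simp)
      have h6 := ih' (c :: d :: v) (by simp)
      have := IsTwo.four (isTwo_length_one a) (isTwo_length_one b) (isTwo_length_one c) hv
        (isTwo_length_two a b) (isTwo_length_two a c) (by simpa using h4)
        (isTwo_length_two b c) (by simpa using h5) (by simpa using h6)
        (by simpa [mul_assoc] using h1) (by simpa [mul_assoc] using h2)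
        (by simpa [mul_assoc] using h3) (isTwo_length_three a b c)
      simpa [mul_assoc] using this

theorem isTwo_all (x : FreeGroup (Fin n)) : IsTwo x := by
  have key : ∀ w : List (Fin n), IsTwo (x * (w.map FreeGroup.of).prod) := by
    have hx : x ∈ Subgroup.closure (Set.range (FreeGroup.of (α := Fin n))) := by
      rw [FreeGroup.closure_range_of]
      trivial
    induction hx using Subgroup.closure_induction_right with
    | one => intro w; rw [one_mul]; exact isTwo_word w
    | mul_right x hx y hy ih =>
      obtain ⟨a, rfl⟩ := hy
      intro w
      simpa [mul_assoc] using ih (a :: w)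
    | mul_inv_cancel x hx y hy ih =>
      obtain ⟨a, rfl⟩ := hy
      intro w
      apply IsTwo.comm
      rw [← mul_assoc, ← IsTwo.mul_iff (ih w).comm (isTwo_length_one a), mul_assoc]
      apply IsTwo.comm
      simpa [mul_assoc] using ih (a :: w)
  simpa using key []

/-- `J` contains `tr x - 2` for every `x`. -/
theorem tr_sub_two_mem_J (x : FreeGroup (Fin n)) : tr x - 2 ∈ J n := by
  apply Ideal.Quotient.eq.1
  rw [map_ofNat]
  exact isTwo_all x

/-- The powers of `J` are stable under `Aut F_n`. -/
theorem J_pow_invariant (k : ℕ) (σ : MulAut (FreeGroup (Fin n)))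
    {f : FrickeRing (FreeGroup (Fin n))} (hf : f ∈ J n ^ k) : frickeAct σ f ∈ J n ^ k := by
  have h1 : (J n).map (frickeAct σ) ≤ J n := by
    rw [J, Ideal.map_span, Ideal.span_le]
    rintro _ ⟨_, ⟨w, -, -, -, rfl⟩, rfl⟩
    rw [map_sub, frickeAct_tr, map_ofNat]
    exact tr_sub_two_mem_J _
  have h2 := Ideal.mem_map_of_mem (frickeAct σ) hf
  rw [Ideal.map_pow] at h2
  exact Ideal.pow_right_mono h1 k h2

variable (n)

/-- The power `J ^ k` as a `ℚ`-subspace of the ring of Fricke characters. -/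
def JPow (k : ℕ) : Submodule ℚ (FrickeRing (FreeGroup (Fin n))) := (J n ^ k).restrictScalars ℚ

/-- The action of `Aut F_n` on `J`. -/
def actJ : Representation ℚ (MulAut (FreeGroup (Fin n))) (JPow n 1) :=
  (frickeRep (FreeGroup (Fin n))).subrepresentation (JPow n 1)
    fun σ _ hf => J_pow_invariant 1 σ hf

/-- The induced action of `Aut F_n` on `J / J ^ (k + 1)`. -/
def actJQuotient (k : ℕ) : Representation ℚ (MulAut (FreeGroup (Fin n)))
    (JPow n 1 ⧸ (JPow n (k + 1)).submoduleOf (JPow n 1)) :=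
  (actJ n).quotient ((JPow n (k + 1)).submoduleOf (JPow n 1))
    fun σ _ hf => J_pow_invariant (k + 1) σ hf

/-- `E_{F_n}(k)`: the automorphisms of `F_n` that act trivially on `J / J ^ (k + 1)`. -/
def E (k : ℕ) : Subgroup (MulAut (FreeGroup (Fin n))) :=
  (actJQuotient n k).ker

end Free

end Fricke

end

/-!
Restricting Fricke characters to a polynomial family of representations which is trivial at `X = 0`
sends `J` into `(X ^ 2)`, so an element of `E n 1` preserves traces of such families modulo `X ^ 4`.
The second-order terms, together with the third-order terms of words in three generators, show that
it acts trivially on the abelianization `H`. Its Johnson homomorphism `δ : H → Λ²H` is then defined,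
and the third-order terms become `δ x ∧ x = 0` in `Λ³H`; this forces `δ x = μ ∧ x` for a fixed `μ`,
which is the Johnson homomorphism of an inner automorphism.

Conversely, a polynomial identity between traces makes `tr (x y z) - tr (y x z)` additive in `z`
modulo `J ^ 2`. It therefore vanishes modulo `J ^ 2` for `z` in the commutator subgroup, so that
`tr x` modulo `J ^ 2` depends only on `x` modulo `Γ(3)`.
-/

noncomputable section

namespace Fricke

open Matrix
open scoped commutatorElement

section Additive

variable {G M : Type*} [Group G] [AddCommGroup M] {f : G → M}

theorem map_eq_zero_of_mem_commutator (hf : ∀ x y, f (x * y) = f x + f y) {g : G}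
    (hg : g ∈ commutator G) : f g = 0 :=
  let F : G →* Multiplicative M := MonoidHom.mk' (fun x => .ofAdd (f x)) fun x y => by
    rw [hf, ofAdd_add]
  Abelianization.commutator_subset_ker F hg

theorem map_eq_of_div_mem_commutator (hf : ∀ x y, f (x * y) = f x + f y) {x y : G}
    (h : x / y ∈ commutator G) : f x = f y := by
  have hxy := hf (x / y) y
  rwa [div_mul_cancel, map_eq_zero_of_mem_commutator hf h, zero_add] at hxy

end Additive

section FrickeRing

variable {G : Type*} [Group G]

@[elab_as_elim]
theorem frickeRing_induction {p : FrickeRing G → Prop} (f : FrickeRing G)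
    (tr : ∀ x, p (tr x)) (add : ∀ f g, p f → p g → p (f + g))
    (smul : ∀ (c : ℚ) f, p f → p (c • f)) : p f := by
  obtain ⟨f, hf⟩ := f
  have hspan := mem_frickeSubalgebra.1 hf
  induction hspan using Submodule.span_induction with
  | mem f hfx =>
    obtain ⟨x, rfl⟩ := hfx
    exact tr x
  | zero =>
    have h := smul 0 _ (tr 1)
    rwa [zero_smul] at h
  | add f g hf' hg' ihf ihg => exact add ⟨f, hf'⟩ ⟨g, hg'⟩ (ihf hf') (ihg hg')
  | smul c f hf' ih => exact smul c ⟨f, hf'⟩ (ih hf')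

/-- The pairing `(x, y) ↦ 2 tr (x₀ y₀)`, where `x₀ = x - (tr x) / 2` is the traceless part of the
matrix of `x`. -/
def tracelessPairing (x y : G) : FrickeRing G := 2 * tr (x * y) - tr x * tr y

/-- The failure of `tr (x y z)` to be symmetric in `x` and `y`. -/
def trDefect (x y z : G) : FrickeRing G := tr (x * y * z) - tr (y * x * z)

/-- The part of this identity without the factors `tr z` and `tr w` is
`tr ([x, y] [z, w]) = 2 (tr (x w) tr (y z) - tr (x z) tr (y w))` for traceless matrices. -/
theorem four_mul_trDefect_mul (x y z w : G) : 4 * trDefect x y (z * w) =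
    2 * tr z * trDefect x y w + 2 * tr w * trDefect x y z
      + tracelessPairing x w * tracelessPairing y z
      - tracelessPairing x z * tracelessPairing y w := by
  refine Subtype.ext (?_ : 4 * (trFun (x * y * (z * w)) - trFun (y * x * (z * w))) =
    2 * trFun z * (trFun (x * y * w) - trFun (y * x * w))
      + 2 * trFun w * (trFun (x * y * z) - trFun (y * x * z))
      + (2 * trFun (x * w) - trFun x * trFun w) * (2 * trFun (y * z) - trFun y * trFun z)
      - (2 * trFun (x * z) - trFun x * trFun z) * (2 * trFun (y * w) - trFun y * trFun w))
  funext ρ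
  simp only [trFun, Pi.add_apply, Pi.sub_apply, Pi.mul_apply, Pi.ofNat_apply, coe_rep_mul,
    trace_fin_two, Matrix.mul_apply, Fin.sum_univ_two]
  ring

section Ideal

variable {I : Ideal (FrickeRing G)} (hI : ∀ x, tr x - 2 ∈ I)

include hI

theorem tracelessPairing_mem (x y : G) : tracelessPairing x y ∈ I := by
  have h : tracelessPairing x y =
      2 * (tr (x * y) - 2) - (tr x - 2) * tr y - 2 * (tr y - 2) := by
    rw [tracelessPairing]; ring
  rw [h]
  exact I.sub_mem (I.sub_mem (I.mul_mem_left _ (hI _)) (I.mul_mem_right _ (hI _)))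
    (I.mul_mem_left _ (hI _))

theorem trDefect_mem (x y z : G) : trDefect x y z ∈ I := by
  have h : trDefect x y z = (tr (x * y * z) - 2) - (tr (y * x * z) - 2) := by
    rw [trDefect]; ring
  rw [h]
  exact I.sub_mem (hI _) (hI _)

theorem trDefect_mul_sub_mem_sq (x y z w : G) :
    trDefect x y (z * w) - (trDefect x y z + trDefect x y w) ∈ I ^ 2 := by
  have mul_mem_sq {a b : FrickeRing G} (ha : a ∈ I) (hb : b ∈ I) : a * b ∈ I ^ 2 := by
    rw [pow_two]; exact Ideal.mul_mem_mul ha hb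
  have h4 : 4 * (trDefect x y (z * w) - (trDefect x y z + trDefect x y w)) =
      2 * ((tr z - 2) * trDefect x y w) + 2 * ((tr w - 2) * trDefect x y z)
        + tracelessPairing x w * tracelessPairing y z
        - tracelessPairing x z * tracelessPairing y w := by
    linear_combination four_mul_trDefect_mul x y z w
  have hmem : 4 * (trDefect x y (z * w) - (trDefect x y z + trDefect x y w)) ∈ I ^ 2 := by
    rw [h4]
    have hκ := tracelessPairing_mem hI
    have hD := trDefect_mem hI x y
    exact sub_mem (add_mem (add_mem ((I ^ 2).mul_mem_left _ (mul_mem_sq (hI z) (hD w)))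
      ((I ^ 2).mul_mem_left _ (mul_mem_sq (hI w) (hD z)))) (mul_mem_sq (hκ x w) (hκ y z)))
      (mul_mem_sq (hκ x z) (hκ y w))
  have hq := Submodule.smul_of_tower_mem (I ^ 2) (4⁻¹ : ℚ) hmem
  rwa [← map_ofNat (algebraMap ℚ (FrickeRing G)) 4, ← Algebra.smul_def,
    inv_smul_smul₀ four_ne_zero] at hq

theorem trDefect_mem_sq {g : G} (hg : g ∈ commutator G) (x y : G) : trDefect x y g ∈ I ^ 2 :=
  Ideal.Quotient.eq_zero_iff_mem.1 <|
    map_eq_zero_of_mem_commutator (f := fun z => Ideal.Quotient.mk (I ^ 2) (trDefect x y z))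
      (fun z w => by rw [← map_add]; exact Ideal.Quotient.eq.2 (trDefect_mul_sub_mem_sq hI x y z w))
      hg

theorem tr_mul_sub_tr_mem_sq {g : G} (hg : g ∈ (⊤ : Subgroup G).lowerCentralSeries 2) (z : G) :
    tr (g * z) - tr z ∈ I ^ 2 := by
  rw [Subgroup.mem_lowerCentralSeries_succ_iff, Subgroup.top_lowerCentralSeries_one] at hg
  induction hg using Subgroup.closure_induction generalizing z with
  | mem g hg =>
    obtain ⟨c, hc, y, -, rfl⟩ := hg
    have h₁ : tr (⁅c, y⁆ * z) = tr (y * (c⁻¹ * y⁻¹ * z) * c) := by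
      rw [tr_comm _ c, commutatorElement_def]; simp only [mul_assoc]
    have h₂ : tr z = tr (c⁻¹ * y⁻¹ * z * y * c) := by
      rw [tr_comm _ c, ← mul_assoc, tr_comm _ y]; simp only [mul_assoc, mul_inv_cancel_left]
    rw [h₁, h₂]
    exact trDefect_mem_sq hI hc y (c⁻¹ * y⁻¹ * z)
  | one => simp only [one_mul, sub_self, zero_mem]
  | mul x y _ _ hx hy =>
    rw [mul_assoc, ← sub_add_sub_cancel _ (tr (y * z))]
    exact add_mem (hx _) (hy _)
  | inv x _ hx => simpa only [mul_inv_cancel_left, neg_sub] using neg_mem (hx (x⁻¹ * z))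

end Ideal

end FrickeRing

section Filtration

theorem mem_andreadakisJohnson_iff {G : Type*} [Group G] {k : ℕ} {σ : MulAut G} :
    σ ∈ andreadakisJohnson G k ↔
      ∀ x, (QuotientGroup.mk (σ x) : G ⧸ (⊤ : Subgroup G).lowerCentralSeries k) =
        QuotientGroup.mk x := by
  refine MonoidHom.mem_ker.trans ⟨fun h x => DFunLike.congr_fun h (QuotientGroup.mk x),
    fun h => MulEquiv.ext fun x => ?_⟩
  induction x using QuotientGroup.induction_on with
  | H x => exact h x

variable {n : ℕ}

theorem mem_E_iff {k : ℕ} {σ : MulAut (FreeGroup (Fin n))} :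
    σ ∈ E n k ↔ ∀ x, tr (σ x) - tr x ∈ J n ^ (k + 1) := by
  refine ⟨fun h x => ?_, fun h => ?_⟩
  · have hx : tr x - 2 ∈ JPow n 1 := by
      change _ ∈ J n ^ 1
      rw [pow_one]
      exact tr_sub_two_mem_J x
    have hmk := LinearMap.congr_fun (MonoidHom.mem_ker.1 h) (Submodule.Quotient.mk ⟨_, hx⟩)
    have hact : frickeAct σ (tr x - 2) - (tr x - 2) ∈ J n ^ (k + 1) :=
      (Submodule.Quotient.eq ((JPow n (k + 1)).submoduleOf (JPow n 1))).1 hmk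
    rwa [map_sub, frickeAct_tr, map_ofNat, sub_sub_sub_cancel_right] at hact
  · have hact (f : FrickeRing (FreeGroup (Fin n))) : frickeAct σ f - f ∈ J n ^ (k + 1) := by
      induction f using frickeRing_induction with
      | tr x => exact h x
      | add f g hf hg =>
        rw [map_add, add_sub_add_comm]
        exact add_mem hf hg
      | smul c f hf =>
        rw [map_smul, ← smul_sub]
        exact Submodule.smul_of_tower_mem _ c hf
    refine MonoidHom.mem_ker.2 (LinearMap.ext fun v => ?_)
    induction v using Submodule.Quotient.induction_on with
    | _ f => exact (Submodule.Quotient.eq _).2 (hact f.1)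

theorem andreadakisJohnson_two_le_E : andreadakisJohnson (FreeGroup (Fin n)) 2 ≤ E n 1 := by
  refine fun σ hσ => mem_E_iff.2 fun x => ?_
  have hx := QuotientGroup.eq_iff_div_mem.1 (mem_andreadakisJohnson_iff.1 hσ x)
  simpa only [div_mul_cancel] using tr_mul_sub_tr_mem_sq tr_sub_two_mem_J hx x

theorem conj_range_le_E (k : ℕ) :
    (MulAut.conj : FreeGroup (Fin n) →* MulAut (FreeGroup (Fin n))).range ≤ E n k := by
  rintro _ ⟨h, rfl⟩
  refine mem_E_iff.2 fun x => ?_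
  rw [MulAut.conj_apply, mul_assoc, tr_comm, inv_mul_cancel_right, sub_self]
  exact zero_mem _

end Filtration

section Polynomial

open Polynomial

section Coeff

variable {R G : Type*} [CommRing R] [Group G]

/-- The coefficient of `X ^ j` in the matrix `ρ x`, for a polynomial family `ρ` of representations
in `SL₂`. -/
def repCoeff (ρ : G →* SpecialLinearGroup (Fin 2) R[X]) (j : ℕ) (x : G) :
    Matrix (Fin 2) (Fin 2) R :=
  (matPolyEquiv (ρ x).1).coeff j

variable (ρ : G →* SpecialLinearGroup (Fin 2) R[X])

theorem repCoeff_apply (j : ℕ) (x : G) (a b : Fin 2) :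
    repCoeff ρ j x a b = ((ρ x).1 a b).coeff j :=
  matPolyEquiv_coeff_apply _ _ _ _

theorem trace_repCoeff (j : ℕ) (x : G) : trace (repCoeff ρ j x) = (trace (ρ x).1).coeff j := by
  simp only [trace_fin_two, repCoeff_apply, coeff_add]

theorem repCoeff_mul (j : ℕ) (x y : G) : repCoeff ρ j (x * y) =
    ∑ i ∈ Finset.HasAntidiagonal.antidiagonal j, repCoeff ρ i.1 x * repCoeff ρ i.2 y := by
  simp only [repCoeff, map_mul, Matrix.SpecialLinearGroup.coe_mul, coeff_mul]

theorem trace_repCoeff_mul_comm (j : ℕ) (x y : G) :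
    trace (repCoeff ρ j (x * y)) = trace (repCoeff ρ j (y * x)) := by
  rw [trace_repCoeff, trace_repCoeff, map_mul, map_mul, Matrix.SpecialLinearGroup.coe_mul,
    Matrix.SpecialLinearGroup.coe_mul, Matrix.trace_mul_comm]

theorem repCoeff_one {j : ℕ} (hj : j ≠ 0) : repCoeff ρ j 1 = 0 := by
  simp only [repCoeff, map_one, Matrix.SpecialLinearGroup.coe_one, coeff_one, if_neg hj]

/-- This is `g + g⁻¹ = tr g` in `SL₂`. -/
theorem repCoeff_add_inv (j : ℕ) (x : G) :
    repCoeff ρ j x + repCoeff ρ j x⁻¹ = trace (repCoeff ρ j x) • 1 := by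
  ext a b
  fin_cases a <;> fin_cases b <;>
    simp [repCoeff_apply, trace_fin_two, Matrix.SpecialLinearGroup.coe_inv, adjugate_fin_two,
      add_comm]

/-- The family `ρ` specializes to the trivial representation at `X = 0`. -/
def IsTrivialAtZero (ρ : G →* SpecialLinearGroup (Fin 2) R[X]) : Prop :=
  ∀ x, repCoeff ρ 0 x = 1

namespace IsTrivialAtZero

variable {ρ} (hρ : IsTrivialAtZero ρ)

include hρ

theorem repCoeff_one_mul (x y : G) :
    repCoeff ρ 1 (x * y) = repCoeff ρ 1 x + repCoeff ρ 1 y := by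
  simp only [repCoeff_mul, Finset.Nat.sum_antidiagonal_eq_sum_range_succ_mk, Finset.sum_range_succ,
    Finset.range_one, Finset.sum_singleton, tsub_zero, tsub_self, hρ x, hρ y, one_mul, mul_one]
  exact add_comm _ _

theorem repCoeff_two_mul (x y : G) : repCoeff ρ 2 (x * y) =
    repCoeff ρ 2 x + repCoeff ρ 2 y + repCoeff ρ 1 x * repCoeff ρ 1 y := by
  simp only [repCoeff_mul, Finset.Nat.sum_antidiagonal_eq_sum_range_succ_mk, Finset.sum_range_succ,
    Finset.range_one, Finset.sum_singleton, tsub_zero, tsub_self, Nat.reduceSub, hρ x, hρ y,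
    one_mul, mul_one]
  abel

theorem repCoeff_three_mul (x y : G) : repCoeff ρ 3 (x * y) =
    repCoeff ρ 3 x + repCoeff ρ 3 y + repCoeff ρ 1 x * repCoeff ρ 2 y
      + repCoeff ρ 2 x * repCoeff ρ 1 y := by
  simp only [repCoeff_mul, Finset.Nat.sum_antidiagonal_eq_sum_range_succ_mk, Finset.sum_range_succ,
    Finset.range_one, Finset.sum_singleton, tsub_zero, tsub_self, Nat.reduceSub, hρ x, hρ y,
    one_mul, mul_one]
  abel

theorem repCoeff_one_inv (x : G) : repCoeff ρ 1 x⁻¹ = -repCoeff ρ 1 x := by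
  rw [eq_neg_iff_add_eq_zero, ← hρ.repCoeff_one_mul, inv_mul_cancel, repCoeff_one ρ one_ne_zero]

theorem trace_repCoeff_one (x : G) : trace (repCoeff ρ 1 x) = 0 := by
  have h := repCoeff_add_inv ρ 1 x
  rw [hρ.repCoeff_one_inv, add_neg_cancel] at h
  simpa using (congrFun₂ h 0 0).symm

theorem repCoeff_one_mul_self (x : G) :
    repCoeff ρ 1 x * repCoeff ρ 1 x = trace (repCoeff ρ 2 x) • 1 := by
  have h := hρ.repCoeff_two_mul x x⁻¹
  rw [mul_inv_cancel, repCoeff_one ρ two_ne_zero, repCoeff_add_inv, hρ.repCoeff_one_inv, mul_neg,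
    ← sub_eq_add_neg] at h
  exact (sub_eq_zero.1 h.symm).symm

theorem trace_repCoeff_three_eq_zero {x : G} (hx : repCoeff ρ 1 x = 0) :
    trace (repCoeff ρ 3 x) = 0 := by
  have h := hρ.repCoeff_three_mul x x⁻¹
  rw [mul_inv_cancel, repCoeff_one ρ three_ne_zero, repCoeff_add_inv, hρ.repCoeff_one_inv, hx,
    neg_zero, zero_mul, mul_zero, add_zero, add_zero] at h
  simpa using (congrFun₂ h 0 0).symm

theorem trace_repCoeff_three_of_repCoeff_one_eq {x y : G} (h : repCoeff ρ 1 x = repCoeff ρ 1 y) :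
    trace (repCoeff ρ 3 x) = trace (repCoeff ρ 3 y)
      + trace ((repCoeff ρ 2 x - repCoeff ρ 2 y) * repCoeff ρ 1 y) := by
  have hdiv : repCoeff ρ 1 (x / y) = 0 := by
    rw [div_eq_mul_inv, hρ.repCoeff_one_mul, hρ.repCoeff_one_inv, h, add_neg_cancel]
  have h₂ := hρ.repCoeff_two_mul (x / y) y
  have h₃ := hρ.repCoeff_three_mul (x / y) y
  rw [div_mul_cancel, hdiv, zero_mul, add_zero] at h₂ h₃
  rw [h₃, h₂, add_sub_cancel_right, trace_add, trace_add, hρ.trace_repCoeff_three_eq_zero hdiv,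
    zero_add]

theorem trace_repCoeff_three_sub_swap (x y z : G) :
    trace (repCoeff ρ 3 (x * y * z)) - trace (repCoeff ρ 3 (y * x * z)) =
      trace ((repCoeff ρ 1 x * repCoeff ρ 1 y - repCoeff ρ 1 y * repCoeff ρ 1 x)
        * repCoeff ρ 1 z) := by
  simp only [hρ.repCoeff_three_mul _ z, hρ.repCoeff_two_mul x y, hρ.repCoeff_two_mul y x,
    hρ.repCoeff_one_mul x y, hρ.repCoeff_one_mul y x, add_mul, sub_mul, trace_add, trace_sub,
    trace_repCoeff_mul_comm ρ 3 y x]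
  ring

theorem X_sq_dvd_trace_sub_two (x : G) : (X : R[X]) ^ 2 ∣ trace (ρ x).1 - 2 := by
  rw [X_pow_dvd_iff]
  intro j hj
  rw [coeff_sub, ← trace_repCoeff]
  interval_cases j
  · rw [hρ x, trace_one, Fintype.card_fin, Nat.cast_ofNat, coeff_ofNat_zero, sub_self]
  · rw [hρ.trace_repCoeff_one, ← C_ofNat, coeff_C_succ, sub_zero]

end IsTrivialAtZero

end Coeff

section Restriction

variable {G : Type*} [Group G] (ρ : G →* SpecialLinearGroup (Fin 2) ℂ[X])

/-- The member of a polynomial family of representations at the parameter value `z`. -/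
def specialize (z : ℂ) : Reps G := (SpecialLinearGroup.map (evalRingHom z)).comp ρ

theorem trFun_specialize (x : G) (z : ℂ) :
    trFun x (specialize ρ z) = (trace (ρ x).1).eval z := by
  simp [trFun, specialize, trace_fin_two]

theorem exists_eval_eq_apply_specialize (f : FrickeRing G) :
    ∃ p : ℂ[X], ∀ z, p.eval z = f.1 (specialize ρ z) := by
  induction f using frickeRing_induction with
  | tr x => exact ⟨_, fun z => (trFun_specialize ρ x z).symm⟩
  | add f g hf hg =>
    obtain ⟨p, hp⟩ := hf
    obtain ⟨q, hq⟩ := hg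
    exact ⟨p + q, fun z => by rw [eval_add, hp, hq]; rfl⟩
  | smul c f hf =>
    obtain ⟨p, hp⟩ := hf
    exact ⟨c • p, fun z => by rw [eval_smul, hp]; rfl⟩

/-- The restriction of Fricke characters to a polynomial family of representations, as a polynomial
in the parameter of the family. -/
def restrictFamily : FrickeRing G →+* ℂ[X] where
  toFun f := (exists_eval_eq_apply_specialize ρ f).choose
  map_one' := Polynomial.funext fun z => by
    rw [(exists_eval_eq_apply_specialize ρ 1).choose_spec, eval_one]; rfl
  map_mul' f g := Polynomial.funext fun z => by
    simp only [eval_mul, (exists_eval_eq_apply_specialize ρ _).choose_spec]; rfl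
  map_zero' := Polynomial.funext fun z => by
    rw [(exists_eval_eq_apply_specialize ρ 0).choose_spec, eval_zero]; rfl
  map_add' f g := Polynomial.funext fun z => by
    simp only [eval_add, (exists_eval_eq_apply_specialize ρ _).choose_spec]; rfl

theorem restrictFamily_tr (x : G) : restrictFamily ρ (tr x) = trace (ρ x).1 :=
  Polynomial.funext fun z =>
    ((exists_eval_eq_apply_specialize ρ (tr x)).choose_spec z).trans (trFun_specialize ρ x z)

end Restriction

section FreeGroup

variable {n : ℕ} {ρ : FreeGroup (Fin n) →* SpecialLinearGroup (Fin 2) ℂ[X]}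

theorem IsTrivialAtZero.X_pow_dvd_restrictFamily (hρ : IsTrivialAtZero ρ) {k : ℕ}
    {f : FrickeRing (FreeGroup (Fin n))} (hf : f ∈ J n ^ k) :
    X ^ (2 * k) ∣ restrictFamily ρ f := by
  have hJ : (J n).map (restrictFamily ρ) ≤ Ideal.span {X ^ 2} := by
    rw [J, Ideal.map_span, Ideal.span_le]
    rintro _ ⟨_, ⟨w, -, -, -, rfl⟩, rfl⟩
    rw [map_sub, restrictFamily_tr, map_ofNat]
    exact Ideal.mem_span_singleton.2 (hρ.X_sq_dvd_trace_sub_two _)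
  have hmap := Ideal.mem_map_of_mem (restrictFamily ρ) hf
  rw [Ideal.map_pow] at hmap
  rw [pow_mul, ← Ideal.mem_span_singleton, ← Ideal.span_singleton_pow]
  exact Ideal.pow_right_mono hJ k hmap

theorem IsTrivialAtZero.trace_repCoeff_eq (hρ : IsTrivialAtZero ρ) {k j : ℕ}
    {σ : MulAut (FreeGroup (Fin n))} (hσ : σ ∈ E n k) (hj : j < 2 * (k + 1))
    (x : FreeGroup (Fin n)) : trace (repCoeff ρ j (σ x)) = trace (repCoeff ρ j x) := by
  have hdvd := hρ.X_pow_dvd_restrictFamily (mem_E_iff.1 hσ x)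
  rw [map_sub, restrictFamily_tr, restrictFamily_tr, X_pow_dvd_iff] at hdvd
  rw [trace_repCoeff, trace_repCoeff, ← sub_eq_zero, ← coeff_sub, hdvd j hj]

end FreeGroup

end Polynomial

section Magnus

variable {ι : Type*}

theorem freeGroup_additive_ext {M : Type*} [AddCommGroup M] {f g : FreeGroup ι → M}
    (hf : ∀ x y, f (x * y) = f x + f y) (hg : ∀ x y, g (x * y) = g x + g y)
    (h : ∀ i, f (.of i) = g (.of i)) (x : FreeGroup ι) : f x = g x := by
  let toHom (f : FreeGroup ι → M) (hf : ∀ x y, f (x * y) = f x + f y) :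
      FreeGroup ι →* Multiplicative M :=
    MonoidHom.mk' (fun x => .ofAdd (f x)) fun x y => by rw [hf, ofAdd_add]
  exact DFunLike.congr_fun (FreeGroup.ext_hom (toHom f hf) (toHom g hg) h) x

/-- Upper unitriangular `3 × 3` matrices; `a`, `b`, `c` are the entries `(0, 1)`, `(1, 2)`,
`(0, 2)`. -/
structure Heisenberg (R : Type*) where
  a : R
  b : R
  c : R

namespace Heisenberg

variable {R : Type*} [Ring R]

instance : Mul (Heisenberg R) := ⟨fun x y => ⟨x.a + y.a, x.b + y.b, x.c + y.c + x.a * y.b⟩⟩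

instance : One (Heisenberg R) := ⟨⟨0, 0, 0⟩⟩

instance : Inv (Heisenberg R) := ⟨fun x => ⟨-x.a, -x.b, -x.c + x.a * x.b⟩⟩

theorem mul_def (x y : Heisenberg R) :
    x * y = ⟨x.a + y.a, x.b + y.b, x.c + y.c + x.a * y.b⟩ := rfl

theorem one_def : (1 : Heisenberg R) = ⟨0, 0, 0⟩ := rfl

theorem inv_def (x : Heisenberg R) : x⁻¹ = ⟨-x.a, -x.b, -x.c + x.a * x.b⟩ := rfl

instance : Group (Heisenberg R) :=
  Group.ofLeftAxioms
    (fun x y z => by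
      simp only [mul_def, mk.injEq, add_assoc, mul_add, add_mul, true_and]; abel)
    (fun x => by simp only [mul_def, one_def, zero_add, zero_mul, add_zero])
    (fun x => by
      simp only [mul_def, one_def, inv_def, mk.injEq, neg_add_cancel, neg_mul, true_and]; abel)

end Heisenberg

variable [DecidableEq ι]

/-- The exponent sum of the generator `k`. -/
def expSum (k : ι) (x : FreeGroup ι) : ℤ :=
  (FreeGroup.lift (fun i => Multiplicative.ofAdd (if i = k then (1 : ℤ) else 0)) x).toAdd

theorem expSum_of (k i : ι) : expSum k (.of i) = if i = k then 1 else 0 := by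
  rw [expSum, FreeGroup.lift_apply_of, toAdd_ofAdd]

theorem expSum_mul (k : ι) (x y : FreeGroup ι) : expSum k (x * y) = expSum k x + expSum k y := by
  rw [expSum, map_mul, toAdd_mul, expSum, expSum]

theorem expSum_inv (k : ι) (x : FreeGroup ι) : expSum k x⁻¹ = -expSum k x := by
  rw [expSum, map_inv, toAdd_inv, expSum]

theorem expSum_eq_zero_of_mem_commutator {x : FreeGroup ι} (hx : x ∈ commutator (FreeGroup ι))
    (k : ι) : expSum k x = 0 :=
  map_eq_zero_of_mem_commutator (expSum_mul k) hx

theorem exists_expSum_eq [Finite ι] (μ : ι → ℤ) : ∃ h : FreeGroup ι, ∀ k, expSum k h = μ k := by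
  suffices hs : ∀ s : Finset ι, ∃ h : FreeGroup ι, ∀ k, expSum k h = if k ∈ s then μ k else 0 by
    have := Fintype.ofFinite ι
    simpa only [Finset.mem_univ, if_true] using hs Finset.univ
  intro s
  induction s using Finset.induction_on with
  | empty => exact ⟨1, fun k => by simp [expSum]⟩
  | insert i s hi ih =>
    obtain ⟨h, hh⟩ := ih
    refine ⟨.of i ^ μ i * h, fun k => ?_⟩
    have hpow : expSum k (.of i ^ μ i : FreeGroup ι) = if i = k then μ i else 0 := by
      simp [expSum]
    rw [expSum_mul, hpow, hh]
    by_cases hik : i = k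
    · subst hik
      simp [hi]
    · simp [hik, Ne.symm hik]

theorem eq_sum_expSum_smul [Fintype ι] {M : Type*} [AddCommGroup M] {f : FreeGroup ι → M}
    (hf : ∀ x y, f (x * y) = f x + f y) (x : FreeGroup ι) :
    f x = ∑ k, expSum k x • f (.of k) := by
  refine freeGroup_additive_ext (g := fun x => ∑ k, expSum k x • f (.of k)) hf (fun x y => ?_)
    (fun i => ?_) x
  · simp only [expSum_mul, add_smul, Finset.sum_add_distrib]
  · simp only [expSum_of, ite_smul, one_smul, zero_smul, Finset.sum_ite_eq, Finset.mem_univ,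
      if_true]

theorem eq_sum_sum_expSum_smul [Fintype ι] {M : Type*} [AddCommGroup M]
    {f : FreeGroup ι → FreeGroup ι → M} (hl : ∀ x y z, f (x * y) z = f x z + f y z)
    (hr : ∀ x y z, f x (y * z) = f x y + f x z) (x y : FreeGroup ι) :
    f x y = ∑ k, ∑ l, (expSum k x * expSum l y) • f (.of k) (.of l) := by
  rw [eq_sum_expSum_smul (f := (f · y)) (hl · · y)]
  refine Finset.sum_congr rfl fun k _ => ?_
  rw [eq_sum_expSum_smul (hr (.of k)), Finset.smul_sum]
  simp only [mul_smul]

theorem div_mem_commutator_of_expSum_eq [Finite ι] {x y : FreeGroup ι}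
    (h : ∀ k, expSum k x = expSum k y) : x / y ∈ commutator (FreeGroup ι) := by
  have := Fintype.ofFinite ι
  have hof (x y : FreeGroup ι) : Additive.ofMul (Abelianization.of (x * y)) =
      Additive.ofMul (Abelianization.of x) + Additive.ofMul (Abelianization.of y) := by
    rw [map_mul, ofMul_mul]
  have hx := eq_sum_expSum_smul hof x
  simp only [h, ← eq_sum_expSum_smul hof y] at hx
  exact QuotientGroup.eq_iff_div_mem.1 hx

/-- The homomorphism to the Heisenberg group with `a = expSum k` and `b = expSum l`; its entry
`c` is `magnusCoeff k l`. -/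
def heisenbergLift (k l : ι) : FreeGroup ι →* Heisenberg ℤ :=
  FreeGroup.lift fun i => ⟨if i = k then 1 else 0, if i = l then 1 else 0, 0⟩

theorem heisenbergLift_of (k l i : ι) : heisenbergLift k l (.of i) =
    ⟨if i = k then 1 else 0, if i = l then 1 else 0, 0⟩ :=
  FreeGroup.lift_apply_of

theorem heisenbergLift_a (k l : ι) (x : FreeGroup ι) : (heisenbergLift k l x).a = expSum k x := by
  refine freeGroup_additive_ext (f := fun x => (heisenbergLift k l x).a) (fun x y => ?_)
    (expSum_mul k) (fun i => ?_) x
  · simp only [map_mul, Heisenberg.mul_def]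
  · simp only [heisenbergLift_of, expSum_of]

theorem heisenbergLift_b (k l : ι) (x : FreeGroup ι) : (heisenbergLift k l x).b = expSum l x := by
  refine freeGroup_additive_ext (f := fun x => (heisenbergLift k l x).b) (fun x y => ?_)
    (expSum_mul l) (fun i => ?_) x
  · simp only [map_mul, Heisenberg.mul_def]
  · simp only [heisenbergLift_of, expSum_of]

/-- The coefficient of the monomial `X_k X_l` in the Magnus expansion of `x`, i.e. in its image
under the homomorphism `x_i ↦ 1 + X_i` to noncommutative power series. -/
def magnusCoeff (k l : ι) (x : FreeGroup ι) : ℤ := (heisenbergLift k l x).c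

theorem magnusCoeff_mul (k l : ι) (x y : FreeGroup ι) : magnusCoeff k l (x * y) =
    magnusCoeff k l x + magnusCoeff k l y + expSum k x * expSum l y := by
  rw [← heisenbergLift_a k l x, ← heisenbergLift_b k l y, magnusCoeff, map_mul]
  rfl

theorem magnusCoeff_one (k l : ι) : magnusCoeff k l 1 = 0 := by
  rw [magnusCoeff, map_one, Heisenberg.one_def]

theorem magnusCoeff_commutator (k l : ι) (x y : FreeGroup ι) :
    magnusCoeff k l ⁅x, y⁆ = expSum k x * expSum l y - expSum k y * expSum l x := by
  have hxy : ⁅x, y⁆ * (y * x) = x * y := by rw [commutatorElement_def]; group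
  have h := congrArg (magnusCoeff k l) hxy
  have h0 : expSum k ⁅x, y⁆ = 0 := expSum_eq_zero_of_mem_commutator
    (Subgroup.commutator_mem_commutator (Subgroup.mem_top x) (Subgroup.mem_top y)) k
  simp only [magnusCoeff_mul, h0, zero_mul, add_zero] at h
  linear_combination h

theorem magnusCoeff_mul_of_mem_commutator (k l : ι) {g : FreeGroup ι}
    (hg : g ∈ commutator (FreeGroup ι)) (x : FreeGroup ι) :
    magnusCoeff k l (g * x) = magnusCoeff k l g + magnusCoeff k l x := by
  rw [magnusCoeff_mul, expSum_eq_zero_of_mem_commutator hg, zero_mul, add_zero]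

theorem expSum_conj (k : ι) (h x : FreeGroup ι) : expSum k (h * x * h⁻¹) = expSum k x := by
  rw [expSum_mul, expSum_mul, expSum_inv]
  ring

theorem magnusCoeff_conj (k l : ι) (h x : FreeGroup ι) : magnusCoeff k l (h * x * h⁻¹) =
    magnusCoeff k l x + (expSum k h * expSum l x - expSum k x * expSum l h) := by
  have hmem : ⁅h, x⁆ ∈ commutator (FreeGroup ι) :=
    Subgroup.commutator_mem_commutator (Subgroup.mem_top h) (Subgroup.mem_top x)
  rw [← magnusCoeff_commutator, add_comm, ← magnusCoeff_mul_of_mem_commutator k l hmem,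
    commutatorElement_def, inv_mul_cancel_right]

theorem magnusCoeff_add_swap_eq [Finite ι] {x y : FreeGroup ι}
    (h : ∀ k, expSum k x = expSum k y) (k l : ι) :
    magnusCoeff k l x + magnusCoeff l k x = magnusCoeff k l y + magnusCoeff l k y := by
  have hshuffle := map_eq_of_div_mem_commutator
    (f := fun x => magnusCoeff k l x + magnusCoeff l k x - expSum k x * expSum l x)
    (fun x y => by simp only [magnusCoeff_mul, expSum_mul]; ring)
    (div_mem_commutator_of_expSum_eq h)
  simpa only [h, sub_left_inj] using hshuffle

end Magnus

section ClassTwo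

variable {G : Type*} [Group G]

instance : CommGroup (Subgroup.center G) :=
  { (inferInstance : Group (Subgroup.center G)) with
    mul_comm := fun a b => Subtype.ext (Subgroup.mem_center_iff.1 b.2 a) }

theorem mk_commutator_mem_center (x y : G) :
    (QuotientGroup.mk ⁅x, y⁆ : G ⧸ (⊤ : Subgroup G).lowerCentralSeries 2) ∈ Subgroup.center _ := by
  rw [Subgroup.mem_center_iff]
  intro z
  induction z using QuotientGroup.induction_on with
  | _ z =>
    have h : ⁅⁅x, y⁆, z⁆ ∈ (⊤ : Subgroup G).lowerCentralSeries 2 :=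
      Subgroup.commutator_mem_commutator
        (Subgroup.commutator_mem_commutator (Subgroup.mem_top x) (Subgroup.mem_top y))
        (Subgroup.mem_top z)
    rw [← QuotientGroup.mk_mul, ← QuotientGroup.mk_mul, eq_comm, QuotientGroup.eq_iff_div_mem]
    rwa [div_eq_mul_inv, _root_.mul_inv_rev, ← mul_assoc]

/-- The commutator of `x` and `y` modulo `Γ(3)`, in additive notation since the values are
central. -/
def commMod (x y : G) : Additive (Subgroup.center (G ⧸ (⊤ : Subgroup G).lowerCentralSeries 2)) :=
  .ofMul ⟨_, mk_commutator_mem_center x y⟩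

theorem coe_commMod (x y : G) : ((commMod x y).toMul : G ⧸ (⊤ : Subgroup G).lowerCentralSeries 2) =
    QuotientGroup.mk ⁅x, y⁆ := rfl

theorem commMod_swap (x y : G) : commMod x y = -commMod y x := by
  refine Additive.toMul.injective (Subtype.ext ?_)
  rw [toMul_neg, Subgroup.coe_inv, coe_commMod, coe_commMod, ← QuotientGroup.mk_inv,
    commutatorElement_inv]

theorem commMod_self (x : G) : commMod x x = 0 := by
  refine Additive.toMul.injective (Subtype.ext ?_)
  rw [coe_commMod, commutatorElement_self]
  rfl

theorem commMod_mul_left (x y z : G) : commMod (x * y) z = commMod x z + commMod y z := by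
  refine Additive.toMul.injective (Subtype.ext ?_)
  have hcomm : ⁅x * y, z⁆ = x * ⁅y, z⁆ * x⁻¹ * ⁅x, z⁆ := by
    simp only [commutatorElement_def]; group
  have hcentral := Subgroup.mem_center_iff.1 (mk_commutator_mem_center y z) (QuotientGroup.mk x)
  rw [toMul_add, mul_comm, Subgroup.coe_mul, coe_commMod, coe_commMod, coe_commMod, hcomm]
  simp only [QuotientGroup.mk_mul, hcentral, QuotientGroup.mk_inv, mul_inv_cancel_right]

theorem commMod_mul_right (x y z : G) : commMod x (y * z) = commMod x y + commMod x z := by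
  rw [commMod_swap, commMod_mul_left, commMod_swap y x, commMod_swap z x, neg_add, neg_neg, neg_neg]

theorem sum_sum_smul_eq_zero_of_symm {ι A : Type*} [Fintype ι] [AddCommGroup A] {m : ι → ι → ℤ}
    {c : ι → ι → A} (hm : ∀ k l, m k l = m l k) (hc : ∀ k l, c k l = -c l k)
    (hc₀ : ∀ k, c k k = 0) : ∑ k, ∑ l, m k l • c k l = 0 := by
  rw [← Fintype.sum_prod_type' (f := fun k l => m k l • c k l)]
  refine Finset.sum_involution (fun p _ => p.swap) (fun p _ => ?_) (fun p _ hp hswap => hp ?_)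
    (fun _ _ => Finset.mem_univ _) (fun p _ => p.swap_swap)
  · rw [Prod.fst_swap, Prod.snd_swap, hm p.2, hc p.2, smul_neg, add_neg_cancel]
  · have hdiag : p.2 = p.1 := congrArg Prod.fst hswap
    rw [hdiag, hc₀, smul_zero]

variable {ι : Type*} [DecidableEq ι]

theorem exists_mk_eq_sum_smul_commMod [Fintype ι] {g : FreeGroup ι}
    (hg : g ∈ commutator (FreeGroup ι)) : ∃ m : ι → ι → ℤ,
    (QuotientGroup.mk g : FreeGroup ι ⧸ (⊤ : Subgroup (FreeGroup ι)).lowerCentralSeries 2) =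
      (∑ k, ∑ l, m k l • commMod (.of k : FreeGroup ι) (.of l)).toMul ∧
    ∀ k l, magnusCoeff k l g = m k l - m l k := by
  rw [commutator_eq_closure] at hg
  induction hg using Subgroup.closure_induction with
  | mem g hg =>
    obtain ⟨x, y, rfl⟩ := hg
    refine ⟨fun k l => expSum k x * expSum l y, ?_, fun k l => ?_⟩
    · rw [← coe_commMod, eq_sum_sum_expSum_smul (f := commMod) commMod_mul_left commMod_mul_right]
    · rw [magnusCoeff_commutator, mul_comm (expSum k y)]
  | one =>
    refine ⟨fun _ _ => 0, ?_, fun k l => by rw [magnusCoeff_one, sub_zero]⟩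
    simp only [zero_smul, Finset.sum_const_zero]
    rfl
  | mul x y hx _ ihx ihy =>
    rw [← commutator_eq_closure] at hx
    obtain ⟨m, hm, hm'⟩ := ihx
    obtain ⟨m', hm₁, hm₁'⟩ := ihy
    refine ⟨m + m', ?_, fun k l => ?_⟩
    · simp only [Pi.add_apply, add_smul, Finset.sum_add_distrib, toMul_add, Subgroup.coe_mul,
        QuotientGroup.mk_mul, hm, hm₁]
    · rw [magnusCoeff_mul_of_mem_commutator k l hx, hm', hm₁']
      simp only [Pi.add_apply]
      ring
  | inv x hx ih =>
    rw [← commutator_eq_closure] at hx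
    obtain ⟨m, hm, hm'⟩ := ih
    refine ⟨-m, ?_, fun k l => ?_⟩
    · simp only [Pi.neg_apply, neg_smul, Finset.sum_neg_distrib, toMul_neg, Subgroup.coe_inv,
        QuotientGroup.mk_inv, hm]
    · have h := magnusCoeff_mul_of_mem_commutator k l (inv_mem hx) x
      rw [inv_mul_cancel, magnusCoeff_one, hm'] at h
      simp only [Pi.neg_apply]
      linear_combination -h

theorem mk_eq_mk_of_magnusCoeff_eq [Finite ι] {x y : FreeGroup ι}
    (hexp : ∀ k, expSum k x = expSum k y) (hmag : ∀ k l, magnusCoeff k l x = magnusCoeff k l y) :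
    (QuotientGroup.mk x : FreeGroup ι ⧸ (⊤ : Subgroup (FreeGroup ι)).lowerCentralSeries 2) =
      QuotientGroup.mk y := by
  have := Fintype.ofFinite ι
  have hdiv := div_mem_commutator_of_expSum_eq hexp
  obtain ⟨m, hm, hm'⟩ := exists_mk_eq_sum_smul_commMod hdiv
  have hsymm (k l : ι) : m k l = m l k := by
    have h := magnusCoeff_mul_of_mem_commutator k l hdiv y
    rw [div_mul_cancel, hmag, hm'] at h
    linear_combination -h
  rw [sum_sum_smul_eq_zero_of_symm hsymm (fun _ _ => commMod_swap _ _) fun _ => commMod_self _,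
    toMul_zero, Subgroup.coe_one, QuotientGroup.eq_one_iff] at hm
  exact QuotientGroup.eq_iff_div_mem.2 hm

end ClassTwo

section CoordinateFamily

open Polynomial

variable {ι R : Type*} [CommRing R]

theorem isTrivialAtZero_of_forall_of {ρ : FreeGroup ι →* SpecialLinearGroup (Fin 2) R[X]}
    (h : ∀ i, repCoeff ρ 0 (.of i) = 1) : IsTrivialAtZero ρ := by
  have hmul (x y : FreeGroup ι) : repCoeff ρ 0 (x * y) = repCoeff ρ 0 x * repCoeff ρ 0 y := by
    rw [repCoeff_mul, Finset.Nat.antidiagonal_zero, Finset.sum_singleton]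
  have hone : repCoeff ρ 0 1 = 1 := by
    rw [repCoeff, map_one, Matrix.SpecialLinearGroup.coe_one, map_one, coeff_one_zero]
  intro x
  induction x using FreeGroup.induction_on with
  | C1 => exact hone
  | of i => exact h i
  | inv_of i hi => rw [← hone, ← inv_mul_cancel (.of i : FreeGroup ι), hmul, hi, mul_one]
  | mul x y hx hy => rw [hmul, hx, hy, one_mul]

/-- A product of three one-parameter unipotent subgroups whose derivative at `X = 0` is the
traceless matrix `!![c, a; b, -c]`. -/
def unipotentProd (a b c : R) : SpecialLinearGroup (Fin 2) R[X] :=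
  ⟨!![1, C (a + c) * X; 0, 1] * !![1, 0; C (b - c) * X, 1] *
      !![1 + C c * X, -(C c * X); C c * X, 1 - C c * X], by
    simp only [det_mul, det_fin_two_of]; ring⟩

theorem coeff_zero_unipotentProd (a b c : R) (i j : Fin 2) :
    ((unipotentProd a b c).1 i j).coeff 0 = (1 : Matrix (Fin 2) (Fin 2) R) i j := by
  fin_cases i <;> fin_cases j <;> simp [unipotentProd]

theorem coeff_one_unipotentProd (a b c : R) (i j : Fin 2) :
    ((unipotentProd a b c).1 i j).coeff 1 = !![c, a; b, -c] i j := by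
  fin_cases i <;> fin_cases j <;> simp [unipotentProd, mul_coeff_one, coeff_one]

variable [DecidableEq ι]

/-- A polynomial family of representations of a free group whose first-order part reads off the
exponent sums of the generators `p`, `q`, `r`; the three need not be distinct. -/
def coordRep (p q r : ι) : FreeGroup ι →* SpecialLinearGroup (Fin 2) ℂ[X] :=
  FreeGroup.lift fun k =>
    unipotentProd (if k = p then 1 else 0) (if k = q then 1 else 0) (if k = r then 1 else 0)

variable (p q r : ι)

theorem isTrivialAtZero_coordRep : IsTrivialAtZero (coordRep p q r) := by
  refine isTrivialAtZero_of_forall_of fun k => ?_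
  ext i j
  rw [repCoeff_apply, coordRep, FreeGroup.lift_apply_of, coeff_zero_unipotentProd]

theorem repCoeff_one_coordRep (x : FreeGroup ι) : repCoeff (coordRep p q r) 1 x =
    !![(expSum r x : ℂ), (expSum p x : ℂ); (expSum q x : ℂ), -(expSum r x : ℂ)] := by
  refine freeGroup_additive_ext (isTrivialAtZero_coordRep p q r).repCoeff_one_mul
    (g := fun x => !![(expSum r x : ℂ), expSum p x; expSum q x, -expSum r x])
    (fun x y => ?_) (fun k => ?_) x
  · simp only [expSum_mul, Int.cast_add]
    ext i j
    fin_cases i <;> fin_cases j <;> simp [add_comm]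
  · ext i j
    rw [repCoeff_apply, coordRep, FreeGroup.lift_apply_of, coeff_one_unipotentProd]
    simp only [expSum_of, Int.cast_ite, Int.cast_one, Int.cast_zero]

theorem trace_bracket_mul_repCoeff_one_coordRep (x y z : FreeGroup ι) :
    trace ((repCoeff (coordRep p q r) 1 x * repCoeff (coordRep p q r) 1 y -
      repCoeff (coordRep p q r) 1 y * repCoeff (coordRep p q r) 1 x) *
        repCoeff (coordRep p q r) 1 z) =
    2 * (!![expSum p x, expSum p y, expSum p z;
      expSum q x, expSum q y, expSum q z;
      expSum r x, expSum r y, expSum r z].det : ℤ) := by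
  simp only [repCoeff_one_coordRep, mul_fin_two, sub_mul, trace_sub, trace_fin_two_of,
    det_fin_three, of_apply, cons_val', cons_val_zero, cons_val_one, cons_val_fin_one, cons_val,
    Int.cast_sub, Int.cast_add, Int.cast_mul]
  ring

/-- The matrix of Magnus coefficients which agrees with the second-order part of `coordRep p q r`
up to an additive function. -/
def magnusMatrix (x : FreeGroup ι) : Matrix (Fin 2) (Fin 2) ℂ :=
  !![(magnusCoeff r r x + magnusCoeff p q x : ℂ), (magnusCoeff r p x - magnusCoeff p r x : ℂ);
    (magnusCoeff q r x - magnusCoeff r q x : ℂ), (magnusCoeff q p x + magnusCoeff r r x : ℂ)]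

theorem repCoeff_two_coordRep_sub_magnusMatrix_mul (x y : FreeGroup ι) :
    repCoeff (coordRep p q r) 2 (x * y) - magnusMatrix p q r (x * y) =
      repCoeff (coordRep p q r) 2 x - magnusMatrix p q r x +
        (repCoeff (coordRep p q r) 2 y - magnusMatrix p q r y) := by
  have hmagnus : magnusMatrix p q r (x * y) = magnusMatrix p q r x + magnusMatrix p q r y +
      repCoeff (coordRep p q r) 1 x * repCoeff (coordRep p q r) 1 y := by
    simp only [repCoeff_one_coordRep, magnusMatrix, magnusCoeff_mul, Int.cast_add, Int.cast_mul]
    ext i j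
    fin_cases i <;> fin_cases j <;> simp <;> ring
  rw [(isTrivialAtZero_coordRep p q r).repCoeff_two_mul, hmagnus]
  abel

theorem repCoeff_two_coordRep_sub [Finite ι] {x y : FreeGroup ι}
    (h : ∀ k, expSum k x = expSum k y) :
    repCoeff (coordRep p q r) 2 x - repCoeff (coordRep p q r) 2 y =
      magnusMatrix p q r x - magnusMatrix p q r y :=
  sub_eq_sub_iff_sub_eq_sub.1 <| map_eq_of_div_mem_commutator
    (f := fun x => repCoeff (coordRep p q r) 2 x - magnusMatrix p q r x)
    (repCoeff_two_coordRep_sub_magnusMatrix_mul p q r) (div_mem_commutator_of_expSum_eq h)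

end CoordinateFamily

section Homology

variable {n : ℕ} {σ : MulAut (FreeGroup (Fin n))}

theorem expSum_mul_add_sq_apply (hσ : σ ∈ E n 1) (p q r : Fin n) (x : FreeGroup (Fin n)) :
    expSum p (σ x) * expSum q (σ x) + expSum r (σ x) ^ 2 =
      expSum p x * expSum q x + expSum r x ^ 2 := by
  have hρ := isTrivialAtZero_coordRep p q r
  have hsq (y : FreeGroup (Fin n)) : trace (repCoeff (coordRep p q r) 2 y) =
      (expSum p y * expSum q y + expSum r y ^ 2 : ℤ) := by
    have h := congrFun₂ (hρ.repCoeff_one_mul_self y) 0 0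
    simp only [repCoeff_one_coordRep, mul_fin_two, of_apply, cons_val', cons_val_zero,
      cons_val_fin_one, Matrix.smul_apply, one_apply_eq, smul_eq_mul, mul_one] at h
    push_cast
    linear_combination -h
  have h := hρ.trace_repCoeff_eq hσ (by norm_num : 2 < 2 * (1 + 1)) x
  rw [hsq, hsq] at h
  exact_mod_cast h

theorem expSum_mul_expSum_apply (hσ : σ ∈ E n 1) (i j : Fin n) (x : FreeGroup (Fin n)) :
    expSum i (σ x) * expSum j (σ x) = expSum i x * expSum j x := by
  linarith [expSum_mul_add_sq_apply hσ i i i x, expSum_mul_add_sq_apply hσ i j i x]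

theorem expSum_apply_mul_expSum_apply (hσ : σ ∈ E n 1) (i : Fin n) (x y : FreeGroup (Fin n)) :
    expSum i (σ x) * expSum i (σ y) = expSum i x * expSum i y := by
  have h := expSum_mul_expSum_apply hσ i i (x * y)
  simp only [map_mul, expSum_mul] at h
  linarith [expSum_mul_expSum_apply hσ i i x, expSum_mul_expSum_apply hσ i i y]

theorem expSum_apply_eq_mul (hσ : σ ∈ E n 1) (i : Fin n) (x : FreeGroup (Fin n)) :
    expSum i (σ x) = expSum i (σ (.of i)) * expSum i x := by
  have hx := expSum_apply_mul_expSum_apply hσ i x (.of i)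
  have hi := expSum_apply_mul_expSum_apply hσ i (.of i) (.of i)
  rw [expSum_of, if_pos rfl] at hx hi
  linear_combination expSum i (σ (.of i)) * hx - expSum i (σ x) * hi

theorem expSum_apply_of_of_ne (hσ : σ ∈ E n 1) {i j : Fin n} (hij : i ≠ j) :
    expSum i (σ (.of j)) = 0 := by
  rw [expSum_apply_eq_mul hσ, expSum_of, if_neg hij.symm, mul_zero]

theorem expSum_apply_of_mul_expSum_apply_of (hσ : σ ∈ E n 1) {i j : Fin n} (hij : i ≠ j) :
    expSum i (σ (.of i)) * expSum j (σ (.of j)) = 1 := by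
  have h := expSum_mul_expSum_apply hσ i j (.of i * .of j)
  simpa [expSum_mul, expSum_of, expSum_apply_of_of_ne hσ hij, expSum_apply_of_of_ne hσ hij.symm,
    hij, hij.symm] using h

/-- The quadratic invariants leave a common sign open in `expSum i (σ x) = ± expSum i x`; this cubic
one decides it. -/
theorem det_expSum_apply (hσ : σ ∈ E n 1) (p q r : Fin n) (x y z : FreeGroup (Fin n)) :
    !![expSum p (σ x), expSum p (σ y), expSum p (σ z);
      expSum q (σ x), expSum q (σ y), expSum q (σ z);
      expSum r (σ x), expSum r (σ y), expSum r (σ z)].det =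
    !![expSum p x, expSum p y, expSum p z;
      expSum q x, expSum q y, expSum q z;
      expSum r x, expSum r y, expSum r z].det := by
  have hρ := isTrivialAtZero_coordRep p q r
  have h := hρ.trace_repCoeff_three_sub_swap (σ x) (σ y) (σ z)
  simp only [← map_mul, hρ.trace_repCoeff_eq hσ (by norm_num : 3 < 2 * (1 + 1))] at h
  rw [hρ.trace_repCoeff_three_sub_swap, trace_bracket_mul_repCoeff_one_coordRep,
    trace_bracket_mul_repCoeff_one_coordRep] at h
  exact_mod_cast (mul_left_cancel₀ two_ne_zero h).symm

theorem expSum_apply_of_mul_mul (hσ : σ ∈ E n 1) {p q r : Fin n} (hpq : p ≠ q) (hpr : p ≠ r)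
    (hqr : q ≠ r) :
    expSum p (σ (.of p)) * expSum q (σ (.of q)) * expSum r (σ (.of r)) = 1 := by
  simpa [det_fin_three, expSum_apply_of_of_ne hσ, expSum_of, hpq, hpr, hqr, hpq.symm, hpr.symm,
    hqr.symm] using det_expSum_apply hσ p q r (.of p) (.of q) (.of r)

theorem expSum_apply (hn : 3 ≤ n) (hσ : σ ∈ E n 1) (i : Fin n) (x : FreeGroup (Fin n)) :
    expSum i (σ x) = expSum i x := by
  obtain ⟨j, hji, -⟩ := Fin.exists_ne_and_ne_of_two_lt i i hn
  obtain ⟨k, hki, hkj⟩ := Fin.exists_ne_and_ne_of_two_lt i j hn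
  have htriple := expSum_apply_of_mul_mul hσ hji.symm hki.symm hkj.symm
  rw [mul_assoc, expSum_apply_of_mul_expSum_apply_of hσ hkj.symm, mul_one] at htriple
  rw [expSum_apply_eq_mul hσ, htriple, one_mul]

end Homology

section Johnson

/-- In coordinates, for `δ : H → Λ²H`: if `δ x ∧ x = 0` in `Λ³H` for all `x`, then `δ x = μ ∧ x` for
a fixed `μ`. -/
theorem exists_eq_wedge_of_wedge_eq_zero {ι : Type*} [DecidableEq ι] [Nontrivial ι]
    {δ : ι → ι → FreeGroup ι → ℤ} (hadd : ∀ k l x y, δ k l (x * y) = δ k l x + δ k l y)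
    (hswap : ∀ k l x, δ k l x = -δ l k x)
    (hwedge : ∀ p q r x, δ p q x * expSum r x + δ q r x * expSum p x + δ r p x * expSum q x = 0) :
    ∃ μ : ι → ℤ, ∀ k l x, δ k l x = μ k * expSum l x - expSum k x * μ l := by
  have hof {k l i : ι} (hki : k ≠ i) (hli : l ≠ i) : δ k l (.of i) = 0 := by
    simpa [expSum_of, hki.symm, hli.symm] using hwedge k l i (.of i)
  have hconst {k l m : ι} (hkl : l ≠ k) (hkm : m ≠ k) : δ k l (.of l) = δ k m (.of m) := by
    obtain rfl | hlm := eq_or_ne l m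
    · rfl
    have h : δ k l (.of l) + δ m k (.of m) = 0 := by
      simpa [expSum_mul, expSum_of, hadd, hof, hkl, hkm, hlm, hkl.symm, hkm.symm, hlm.symm]
        using hwedge k l m (.of l * .of m)
    linarith [hswap m k (.of m)]
  choose other hother using fun k : ι => exists_ne k
  refine ⟨fun k => δ k (other k) (.of (other k)), fun k l => freeGroup_additive_ext (hadd k l)
    (fun x y => by simp only [expSum_mul]; ring) fun i => ?_⟩
  have hdiag : δ k k (.of i) = 0 := by linarith [hswap k k (.of i)]
  simp only [expSum_of]
  obtain rfl | hkl := eq_or_ne k l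
  · rw [hdiag]
    ring
  obtain rfl | hil := eq_or_ne i l
  · simpa [hkl.symm] using hconst hkl.symm (hother k)
  obtain rfl | hik := eq_or_ne i k
  · simpa [hil, hswap i l] using hconst hil (hother l)
  · simpa [hil, hik] using hof hik.symm hil.symm

variable {n : ℕ} {σ : MulAut (FreeGroup (Fin n))}

/-- For `σ` acting trivially on the abelianization, the coordinates of the Johnson homomorphism of
`σ`: the coefficients of `σ x / x ∈ Γ(2) / Γ(3) = Λ²H`. -/
def johnsonCoord (σ : MulAut (FreeGroup (Fin n))) (k l : Fin n) (x : FreeGroup (Fin n)) : ℤ :=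
  magnusCoeff k l (σ x) - magnusCoeff k l x

theorem johnsonCoord_mul (h : ∀ k x, expSum k (σ x) = expSum k x) (k l : Fin n)
    (x y : FreeGroup (Fin n)) :
    johnsonCoord σ k l (x * y) = johnsonCoord σ k l x + johnsonCoord σ k l y := by
  simp only [johnsonCoord, map_mul, magnusCoeff_mul, h]
  ring

theorem johnsonCoord_swap (h : ∀ k x, expSum k (σ x) = expSum k x) (k l : Fin n)
    (x : FreeGroup (Fin n)) : johnsonCoord σ k l x = -johnsonCoord σ l k x := by
  rw [johnsonCoord, johnsonCoord]
  linarith [magnusCoeff_add_swap_eq (h · x) k l]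

theorem johnsonCoord_wedge_eq_zero (h : ∀ k x, expSum k (σ x) = expSum k x) (hσ : σ ∈ E n 1)
    (p q r : Fin n) (x : FreeGroup (Fin n)) :
    johnsonCoord σ p q x * expSum r x + johnsonCoord σ q r x * expSum p x +
      johnsonCoord σ r p x * expSum q x = 0 := by
  have hρ := isTrivialAtZero_coordRep p q r
  have htrace := hρ.trace_repCoeff_three_of_repCoeff_one_eq (x := σ x) (y := x)
    (by simp only [repCoeff_one_coordRep, h])
  rw [hρ.trace_repCoeff_eq hσ (by norm_num), repCoeff_two_coordRep_sub p q r (h · x)] at htrace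
  have hdiff : magnusMatrix p q r (σ x) - magnusMatrix p q r x =
      !![(johnsonCoord σ p q x : ℂ), 2 * (johnsonCoord σ r p x : ℂ);
        2 * (johnsonCoord σ q r x : ℂ), -(johnsonCoord σ p q x : ℂ)] := by
    have hcast (k l : Fin n) : (magnusCoeff k l (σ x) : ℂ) =
        magnusCoeff k l x + (johnsonCoord σ k l x : ℂ) := by
      rw [johnsonCoord, Int.cast_sub, add_sub_cancel]
    have hdiag : johnsonCoord σ r r x = 0 := by linarith [johnsonCoord_swap h r r x]
    simp only [magnusMatrix, hcast, hdiag, johnsonCoord_swap h p r, johnsonCoord_swap h r q,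
      johnsonCoord_swap h q p]
    ext i j
    fin_cases i <;> fin_cases j <;> simp <;> ring
  rw [hdiff, repCoeff_one_coordRep, left_eq_add] at htrace
  have htwo : (2 * (johnsonCoord σ p q x * expSum r x + johnsonCoord σ q r x * expSum p x +
      johnsonCoord σ r p x * expSum q x) : ℂ) = 0 := by
    rw [← htrace]
    simp only [mul_fin_two, trace_fin_two_of]
    ring
  exact_mod_cast (mul_eq_zero.1 htwo).resolve_left two_ne_zero

theorem exists_mk_eq_mk_conj (hn : 3 ≤ n) (hσ : σ ∈ E n 1) :
    ∃ h : FreeGroup (Fin n), ∀ x, (QuotientGroup.mk (σ x) :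
      FreeGroup (Fin n) ⧸ (⊤ : Subgroup (FreeGroup (Fin n))).lowerCentralSeries 2) =
        QuotientGroup.mk (h * x * h⁻¹) := by
  have : Nontrivial (Fin n) := Fin.nontrivial_iff_two_le.2 (by lia)
  have hH := expSum_apply hn hσ
  obtain ⟨μ, hμ⟩ := exists_eq_wedge_of_wedge_eq_zero (johnsonCoord_mul hH) (johnsonCoord_swap hH)
    (johnsonCoord_wedge_eq_zero hH hσ)
  obtain ⟨h, hh⟩ := exists_expSum_eq μ
  refine ⟨h, fun x => mk_eq_mk_of_magnusCoeff_eq (fun k => ?_) fun k l => ?_⟩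
  · rw [hH, expSum_conj]
  · rw [magnusCoeff_conj, hh, hh, ← hμ, johnsonCoord, add_sub_cancel]

end Johnson

end Fricke

end

open scoped Pointwise in
theorem mainTheorem2 (n : ℕ) (hn : 3 ≤ n) :
    (Fricke.E n 1 : Set (MulAut (FreeGroup (Fin n)))) =
      ((MulAut.conj : FreeGroup (Fin n) →* MulAut (FreeGroup (Fin n))).range :
          Set (MulAut (FreeGroup (Fin n)))) *
        (Fricke.andreadakisJohnson (FreeGroup (Fin n)) 2 : Set (MulAut (FreeGroup (Fin n)))) := by
  refine Set.Subset.antisymm (fun σ hσ => ?_) ?_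
  · obtain ⟨h, hh⟩ := Fricke.exists_mk_eq_mk_conj hn hσ
    refine Set.mem_mul.2 ⟨MulAut.conj h, ⟨h, rfl⟩, (MulAut.conj h)⁻¹ * σ,
      Fricke.mem_andreadakisJohnson_iff.2 fun x => ?_, mul_inv_cancel_left _ _⟩
    rw [MulAut.mul_apply, MulAut.conj_inv_apply, QuotientGroup.mk_mul, QuotientGroup.mk_mul, hh,
      ← QuotientGroup.mk_mul, ← QuotientGroup.mk_mul]
    congr 1
    group
  · rintro _ ⟨σ, hσ, τ, hτ, rfl⟩
    exact mul_mem (Fricke.conj_range_le_E 1 hσ) (Fricke.andreadakisJohnson_two_le_E hτ)
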